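/- Let $n\in\mathbb{N}=\{0,1,2,\dots\}$ and $\alpha,\beta>0$. For $z>0$ consider the generalized Meixner weight $$\omega(k)=\frac{(\alpha)_k\,z^k}{(\beta)_k\,k!},\qquad k=0,1,2,\dots,$$ its moments $\mu_j(z)=\sum_{k\ge0}k^j\omega(k)$ and the Hankel determinant $\Delta_n(z;\alpha,\beta)=\det\big(\mu_{i+j}(z)\big)_{i,j=0}^{n-1}$ (with $\Delta_0=1$). Let $M(\alpha,\beta,z)=\sum_{k\ge0}\frac{(\alpha)_k}{(\beta)_k\,k!}z^k$ be the Kummer function, $\delta_z=z\frac{d}{dz}$, and $\mathcal W_n(\psi)=\det\big(\delta_z^{\,i+j}\psi\big)_{i,j=0}^{n-1}$. (1) For every $z>0$ all the moments converge, $\Delta_n(z;\alpha,\beta)=\mathcal W_n\big(M(\alpha,\beta,z)\big)>0$, this function is differentiable in $z$, and the function $$S_n(z;\alpha,\beta)=z\frac{d}{dz}\ln\Delta_n(z;\alpha,\beta)$$ is twice differentiable and satisfies $$\left(z\frac{d^2S_n}{dz^2}\right)^{2}=\left[(z+n+\beta-1)\frac{dS_n}{dz}-S_n-\tfrac12n(n-1+2\alpha)\right]^2-4\frac{dS_n}{dz}\left(\frac{dS_n}{dz}-n-\alpha+\beta\right)\left[z\frac{dS_n}{dz}-S_n+\tfrac12n(n-1)\right].\qquad(*)$$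 (2) Put $\kappa_1=\tfrac14(2\alpha-\beta-n-1)$, $\kappa_2=-\tfrac14(2\alpha+\beta+n-3)$, $\kappa_3=\tfrac14(2\alpha-\beta+3n-1)$, $\kappa_4=-\tfrac14(2\alpha-3\beta+n+1)$. Under the affine shift $$S=\sigma+\tfrac14(2\alpha-\beta+3n-1)z+\tfrac58n^2+\tfrac14(2\alpha-3\beta-1)n+\tfrac18(2\alpha-\beta-1)^2,$$ a twice differentiable function $S$ satisfies $(*)$ if and only if $\sigma$ satisfies the Jimbo–Miwa–Okamoto $\sigma$-equation $$\left(z\sigma''\right)^2-\left\{2(\sigma')^2-z\sigma'+\sigma\right\}^2+4\prod_{j=1}^4(\sigma'+\kappa_j)=0 .\qquad(**)$$ In particular the function $\sigma$ obtained from $S=S_n(z;\alpha,\beta)$ satisfies $(**)$ for $z>0$. (3) For real $a,b,\theta$, one has $\kappa_1=\tfrac14\theta+\tfrac12a$, $\kappa_2=\tfrac14\theta-\tfrac12a$, $\kappa_3=-\tfrac14\theta-\tfrac12b$, $\kappa_4=-\tfrac14\theta+\tfrac12b$ if and only if $(a,b,\theta)=(\alpha-1,\ \beta-\alpha-n,\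 1-\beta-n)$. For these values $(**)$ belongs to the fifth Painlevé equation in the following sense. Let $$\mathcal H_{\rm V}(q,p,z)=q(q-1)^2p^2-\{(b+\theta)q^2-(2b+\theta-z)q+b\}p-\tfrac14\{a^2-(b+\theta)^2\}q .$$ If $q,p$ are differentiable and solve $zq'=\partial\mathcal H_{\rm V}/\partial p$, $zp'=-\partial\mathcal H_{\rm V}/\partial q$ on an open subset of $(0,\infty)$, then $q$ and $\sigma(z)=\mathcal H_{\rm V}(q(z),p(z),z)+\tfrac14(2b+\theta)z-\tfrac18(2b+\theta)^2$ are twice differentiable there, $\sigma$ satisfies $(**)$, and $w=q$ satisfies, wherever $q\ne0,1$, $$w''=\left(\frac1{2w}+\frac1{w-1}\right)(w')^2-\frac{w'}{z}+\frac{(w-1)^2}{z^2}\left(Aw+\frac Bw\right)+\frac{Cw}{z}-\frac{w(w+1)}{2(w-1)}$$ with $(A,B,C)=\big(\tfrac12(\alpha-1)^2,\,-\tfrac12(\beta-\alpha-n)^2,\,\beta+n-2\big)$. -/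

import Mathlib

open scoped Topology Nat

namespace GenMeixner

noncomputable section

/-- The Pochhammer symbol `(a)_k = a (a+1) ⋯ (a+k-1)`. -/
def poch (a : ℝ) (k : ℕ) : ℝ := (ascPochhammer ℝ k).eval a

/-- The generalized Meixner weight `ω(k) = (α)_k z^k / ((β)_k k!)` on the lattice `ℕ`. -/
def weight (α β z : ℝ) (k : ℕ) : ℝ := poch α k * z ^ k / (poch β k * (k ! : ℝ))

/-- The moment `μ_j(z) = ∑_k k^j ω(k)` of the generalized Meixner weight (with `0^0 = 1`). -/
def moment (α β z : ℝ) (j : ℕ) : ℝ := ∑' k : ℕ, (k : ℝ) ^ j * weight α β z k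

/-- The `n × n` Hankel determinant `det (μ_{i+j})` of the moments; it is `1` for `n = 0`. -/
def hankelDet (n : ℕ) (α β z : ℝ) : ℝ :=
  Matrix.det (Matrix.of fun i j : Fin n => moment α β z ((i : ℕ) + (j : ℕ)))

/-- The Kummer function `M(α, β, z) = ∑_k (α)_k / ((β)_k k!) z^k`. -/
def kummerM (α β z : ℝ) : ℝ := ∑' k : ℕ, poch α k / (poch β k * (k ! : ℝ)) * z ^ k

/-- The operator `δ = z d/dz`. -/
def eulerOp (f : ℝ → ℝ) : ℝ → ℝ := fun z => z * deriv f z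

/-- The `n × n` determinant `W_n(ψ) = det (δ^{i+j} ψ)`, `0 ≤ i, j ≤ n - 1`;
it is `1` for `n = 0`. -/
def wronskianDet (n : ℕ) (ψ : ℝ → ℝ) (z : ℝ) : ℝ :=
  Matrix.det (Matrix.of fun i j : Fin n => (eulerOp^[(i : ℕ) + (j : ℕ)] ψ) z)

/-- `S_n(z; α, β) = z d/dz ln W_n(M(α, β, z))`. -/
def S (n : ℕ) (α β : ℝ) : ℝ → ℝ :=
  eulerOp fun z => Real.log (wronskianDet n (kummerM α β) z)

/-- `f` is twice differentiable at `z`. -/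
def TwiceDifferentiableAt (f : ℝ → ℝ) (z : ℝ) : Prop :=
  (∀ᶠ y in 𝓝 z, DifferentiableAt ℝ f y) ∧ DifferentiableAt ℝ (deriv f) z

/-- The second-order, second-degree equation for `S_n`, at the point `z`. -/
def SEquation (n : ℕ) (α β : ℝ) (f : ℝ → ℝ) (z : ℝ) : Prop :=
  (z * deriv (deriv f) z) ^ 2
    = ((z + n + β - 1) * deriv f z - f z - (1 / 2 : ℝ) * n * (n - 1 + 2 * α)) ^ 2
      - 4 * deriv f z * (deriv f z - n - α + β)
        * (z * deriv f z - f z + (1 / 2 : ℝ) * n * (n - 1))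

/-- The Jimbo–Miwa–Okamoto `σ`-equation of the fifth Painlevé equation, with parameters
`κ_1, …, κ_4`, at the point `z`. -/
def SigmaEquation (κ : Fin 4 → ℝ) (σ : ℝ → ℝ) (z : ℝ) : Prop :=
  (z * deriv (deriv σ) z) ^ 2 - (2 * deriv σ z ^ 2 - z * deriv σ z + σ z) ^ 2
    + 4 * ∏ j, (deriv σ z + κ j) = 0

/-- The affine function of `z` by which `S_n` and `σ` differ. -/
def shift (n : ℕ) (α β z : ℝ) : ℝ :=
  (1 / 4 : ℝ) * (2 * α - β + 3 * n - 1) * z + (5 / 8 : ℝ) * n ^ 2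
    + (1 / 4 : ℝ) * (2 * α - 3 * β - 1) * n + (1 / 8 : ℝ) * (2 * α - β - 1) ^ 2

/-- The parameters `κ_1, …, κ_4` attached to `S_n(z; α, β)`. -/
def kappa (n : ℕ) (α β : ℝ) : Fin 4 → ℝ :=
  ![(1 / 4 : ℝ) * (2 * α - β - n - 1),
    -((1 / 4 : ℝ) * (2 * α + β + n - 3)),
    (1 / 4 : ℝ) * (2 * α - β + 3 * n - 1),
    -((1 / 4 : ℝ) * (2 * α - 3 * β + n + 1))]

/-- The parameters `κ_1, …, κ_4` of the `σ`-equation belonging to the parameters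
`(a, b, θ)` of the Hamiltonian of the fifth Painlevé equation. -/
def kappaPV (a b θ : ℝ) : Fin 4 → ℝ :=
  ![(1 / 4 : ℝ) * θ + (1 / 2 : ℝ) * a, (1 / 4 : ℝ) * θ - (1 / 2 : ℝ) * a,
    -((1 / 4 : ℝ) * θ) - (1 / 2 : ℝ) * b, -((1 / 4 : ℝ) * θ) + (1 / 2 : ℝ) * b]

/-- The Hamiltonian `H_V(q, p, z)` of the fifth Painlevé equation. -/
def hamV (a b θ q p z : ℝ) : ℝ :=
  q * (q - 1) ^ 2 * p ^ 2 - ((b + θ) * q ^ 2 - (2 * b + θ - z) * q + b) * p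
    - (1 / 4 : ℝ) * (a ^ 2 - (b + θ) ^ 2) * q

/-- `(q, p)` solves `z q' = ∂H_V/∂p`, `z p' = -∂H_V/∂q` on `U`. -/
def IsHamiltonianSolution (a b θ : ℝ) (U : Set ℝ) (q p : ℝ → ℝ) : Prop :=
  ∀ z ∈ U, DifferentiableAt ℝ q z ∧ DifferentiableAt ℝ p z ∧
    z * deriv q z = deriv (fun y => hamV a b θ (q z) y z) (p z) ∧
    z * deriv p z = -deriv (fun x => hamV a b θ x (p z) z) (q z)

/-- The function `σ` built from the Hamiltonian along `(q, p)`. -/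
def sigmaOfHam (a b θ : ℝ) (q p : ℝ → ℝ) (z : ℝ) : ℝ :=
  hamV a b θ (q z) (p z) z + (1 / 4 : ℝ) * (2 * b + θ) * z - (1 / 8 : ℝ) * (2 * b + θ) ^ 2

/-- The fifth Painlevé equation with parameters `(A, B, C, D)`, at the point `z`
(meaningful where `z ≠ 0` and `w z ≠ 0, 1`). -/
def PainleveV (A B C D : ℝ) (w : ℝ → ℝ) (z : ℝ) : Prop :=
  deriv (deriv w) z
    = (1 / (2 * w z) + 1 / (w z - 1)) * deriv w z ^ 2 - 1 / z * deriv w z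
      + (w z - 1) ^ 2 / z ^ 2 * (A * w z + B / w z) + C * w z / z
      + D * w z * (w z + 1) / (w z - 1)

end

end GenMeixner

/-!
The equation for `S_n` is proved through the monic orthogonal polynomials `P_n` of the weight
(`GenMeixner.op`). Write `L` for the moment functional, `h_n = L (P_n ^ 2)`,
`X P_n = P_{n+1} + b_n P_n + a_n P_{n-1}` with `a_n = h_n / h_{n-1}` and `a_0 = 0`, and
`s_n = b_0 + ⋯ + b_{n-1}`, so that `P_n = X ^ n - s_n X ^ (n - 1) + ⋯`.

Two facts about the weight are used. As `δ = z d/dz` multiplies the `k`-th term of the moments by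
`k`, it acts on the moment functional as multiplication by `X`. This gives the Toda equations
`δ h_n = b_n h_n` and `δ s_n = a_n`; together with `Δ_n = h_0 ⋯ h_{n-1}` they show `S_n = s_n`,
`z S_n' = a_n` and `z ^ 2 S_n'' = a_n (b_n - b_{n-1} - 1)`. On the other hand the Pearson equation
`L (X (X + β - 1) p) = z L ((X + α) p(X + 1))`, applied to `P_n(x) P_m(x - 1)` for `m = n` and
`m = n - 1`, compares top coefficients only and yields
`a_{n+1} + a_n + b_n ^ 2 + (β - 1 - n) b_n - n (β - 1) + n (n - 1) / 2 - s_n = z (b_n + n + α)`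
(`quadratic_relation`) and
`a_n (b_n + b_{n-1} + β - n) = z (a_n + n α + n (n - 1) / 2 + s_n)` (`linear_relation`). These have
the first integral
`a_n (n + z - b_n) (n - 1 + z - b_{n-1}) = (a_n - z (n + α - β)) (a_n - s_n + n (n - 1) / 2)`
(`factorized_relation`, an induction on `n`). Eliminating `b_n` and `b_{n-1}` from
`z ^ 2 S_n''` by the linear relation and the first integral is exactly the equation for `S_n`.

The affine shift is an identity of polynomials in `z, S, S', S''`. For the Hamiltonian system,
`σ' = -q p + (2 b + θ) / 4` because the Hamiltonian changes along solutions only through its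
explicit dependence on `z`; differentiating once more with the system expresses `σ''` and `q''` as
rational functions of `q, p, z`, and the `σ`-equation and the fifth Painlevé equation become
identities.
-/

namespace GenMeixner

open Polynomial

/-! ### Monic orthogonal polynomials of a positive functional -/

noncomputable section

variable (L : ℝ[X] →ₗ[ℝ] ℝ)

/-- The pair `(P_n, P_{n-1})` of consecutive monic orthogonal polynomials of the functional `L`,
computed by the three-term recurrence. It starts from `(P_0, P_{-1}) = (1, 0)`; the quotient
`L (P_0 ^ 2) / L (P_{-1} ^ 2)` of the first step has denominator `0` and multiplies `P_{-1} = 0`. -/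
def opPair : ℕ → ℝ[X] × ℝ[X]
  | 0 => (1, 0)
  | n + 1 =>
    ((X - C (L (X * (opPair n).1 * (opPair n).1) / L ((opPair n).1 * (opPair n).1))) * (opPair n).1
      - C (L ((opPair n).1 * (opPair n).1) / L ((opPair n).2 * (opPair n).2)) * (opPair n).2,
      (opPair n).1)

/-- The monic orthogonal polynomial of degree `n` of the functional `L`. -/
def op (n : ℕ) : ℝ[X] := (opPair L n).1

/-- The squared norm `h_n = L (P_n ^ 2)`. -/
def sqNorm (n : ℕ) : ℝ := L (op L n * op L n)

/-- The recurrence coefficient `b_n` in `X P_n = P_{n+1} + b_n P_n + a_n P_{n-1}`. -/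
def recB (n : ℕ) : ℝ := L (X * op L n * op L n) / sqNorm L n

/-- The recurrence coefficient `a_n = h_n / h_{n-1}` in
`X P_n = P_{n+1} + b_n P_n + a_n P_{n-1}`, with `a_0 = 0`. -/
def recA : ℕ → ℝ
  | 0 => 0
  | n + 1 => sqNorm L (n + 1) / sqNorm L n

/-- The sum `s_n = b_0 + ⋯ + b_{n-1}`; the second coefficient of `P_n` is `-s_n`. -/
def sumB (n : ℕ) : ℝ := ∑ k ∈ Finset.range n, recB L k

lemma op_zero : op L 0 = 1 := rfl

/-- The three-term recurrence. For `n = 0` the truncated index `n - 1` is harmless because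
`a_0 = 0`. -/
lemma op_succ (n : ℕ) :
    op L (n + 1) = (X - C (recB L n)) * op L n - C (recA L n) * op L (n - 1) := by
  cases n with
  | zero => simp [op, opPair, recB, recA, sqNorm]
  | succ n => rfl

lemma X_mul_op (n : ℕ) :
    X * op L n = op L (n + 1) + C (recB L n) * op L n + C (recA L n) * op L (n - 1) := by
  rw [op_succ]; ring

lemma sumB_succ (n : ℕ) : sumB L (n + 1) = sumB L n + recB L n := Finset.sum_range_succ _ _

lemma op_coeff (n : ℕ) : (op L n).coeff n = 1 ∧ ∀ m, n < m → (op L n).coeff m = 0 := by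
  induction n using Nat.strong_induction_on with
  | _ n ih =>
    cases n with
    | zero => simpa [op_zero, coeff_one] using fun m hm => by omega
    | succ n =>
      have hn := ih n (by omega)
      have hp : ∀ m, n < m → recA L n * (op L (n - 1)).coeff m = 0 := by
        intro m hm
        rw [(ih (n - 1) (by omega)).2 m (by omega), mul_zero]
      refine ⟨?_, fun m hm => ?_⟩
      · rw [op_succ, sub_mul, coeff_sub, coeff_sub, coeff_X_mul, coeff_C_mul, coeff_C_mul,
          hp _ (by omega), hn.1, hn.2 _ (by omega)]
        ring
      · obtain ⟨m, rfl⟩ : ∃ k, m = k + 1 := ⟨m - 1, by omega⟩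
        rw [op_succ, sub_mul, coeff_sub, coeff_sub, coeff_X_mul, coeff_C_mul, coeff_C_mul,
          hp _ (by omega), hn.2 _ (by omega), hn.2 _ (by omega)]
        ring

lemma op_coeff_self (n : ℕ) : (op L n).coeff n = 1 := (op_coeff L n).1

lemma op_coeff_of_lt {n m : ℕ} (h : n < m) : (op L n).coeff m = 0 := (op_coeff L n).2 m h

lemma op_degree_lt {n m : ℕ} (h : n < m) : (op L n).degree < m :=
  (degree_lt_iff_coeff_zero _ _).2 fun _ hk => op_coeff_of_lt L (h.trans_le hk)

lemma op_natDegree_le (n : ℕ) : (op L n).natDegree ≤ n :=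
  natDegree_le_iff_coeff_eq_zero.2 fun _ hk => op_coeff_of_lt L hk

lemma op_ne_zero (n : ℕ) : op L n ≠ 0 := fun h => by
  have := op_coeff_self L n
  simp [h] at this

/-- The coefficient of `X ^ (n - 1)` in `P_n` is `-s_n`; multiplying by `X` includes `n = 0`. -/
lemma X_mul_op_coeff (n : ℕ) : (X * op L n).coeff n = -sumB L n := by
  induction n with
  | zero => simp [sumB]
  | succ n ih =>
    rw [coeff_X_mul, op_succ, sub_mul, coeff_sub, coeff_sub, coeff_C_mul, coeff_C_mul, ih,
      op_coeff_self, sumB_succ]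
    have : recA L n * (op L (n - 1)).coeff n = 0 := by
      cases n with
      | zero => simp [recA]
      | succ n => rw [op_coeff_of_lt L (by omega), mul_zero]
    rw [this]; ring

lemma op_succ_coeff (n : ℕ) : (op L (n + 1)).coeff n = -sumB L (n + 1) := by
  rw [← X_mul_op_coeff, coeff_X_mul]

variable {L} (hL : ∀ p : ℝ[X], p ≠ 0 → 0 < L (p * p))
include hL

lemma sqNorm_pos (n : ℕ) : 0 < sqNorm L n := hL _ (op_ne_zero L n)

lemma recB_mul_sqNorm (n : ℕ) : recB L n * sqNorm L n = L (X * op L n * op L n) :=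
  div_mul_cancel₀ _ (sqNorm_pos hL n).ne'

lemma recA_succ_mul_sqNorm (n : ℕ) : recA L (n + 1) * sqNorm L n = sqNorm L (n + 1) :=
  div_mul_cancel₀ _ (sqNorm_pos hL n).ne'

end

section
variable {L : ℝ[X] →ₗ[ℝ] ℝ} (hL : ∀ p : ℝ[X], p ≠ 0 → 0 < L (p * p))

lemma map_C_mul (L : ℝ[X] →ₗ[ℝ] ℝ) (c : ℝ) (p : ℝ[X]) : L (C c * p) = c * L p := by
  rw [← smul_eq_C_mul, map_smul, smul_eq_mul]

lemma degree_sub_op_lt {d : ℕ} {p : ℝ[X]} (hp : p.degree < (d + 1 : ℕ)) :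
    (p - C (p.coeff d) * op L d).degree < d := by
  rw [degree_lt_iff_coeff_zero] at hp ⊢
  intro m hm
  rw [coeff_sub, coeff_C_mul]
  rcases hm.eq_or_lt with rfl | h
  · rw [op_coeff_self]; ring
  · rw [hp m h, op_coeff_of_lt L h]; ring

lemma pairing_eq_zero_of_orthogonal {n : ℕ} (h : ∀ m < n, L (op L n * op L m) = 0) {d : ℕ}
    (hd : d ≤ n) {p : ℝ[X]} (hp : p.degree < d) : L (op L n * p) = 0 := by
  induction d generalizing p with
  | zero =>
    have : p = 0 := by
      ext m
      exact (degree_lt_iff_coeff_zero _ _).1 hp m (Nat.zero_le _)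
    simp [this]
  | succ d ih =>
    have h1 := ih (by omega) (degree_sub_op_lt (L := L) hp)
    have h2 : op L n * p = op L n * (p - C (p.coeff d) * op L d)
        + C (p.coeff d) * (op L n * op L d) := by ring
    rw [h2, map_add, h1, map_C_mul, h d (by omega)]; ring

include hL

lemma op_orthogonal {n m : ℕ} (hm : m < n) : L (op L n * op L m) = 0 := by
  induction n using Nat.strong_induction_on generalizing m with
  | _ n ih =>
    obtain ⟨n, rfl⟩ : ∃ k, n = k + 1 := ⟨n - 1, by omega⟩
    have hlow : ∀ p : ℝ[X], p.degree < n → L (op L n * p) = 0 := fun p hp =>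
      pairing_eq_zero_of_orthogonal (fun m hm => ih n (by omega) hm) le_rfl hp
    have hexp : L (op L (n + 1) * op L m)
        = L (op L n * (X * op L m)) - recB L n * L (op L n * op L m)
          - recA L n * L (op L (n - 1) * op L m) := by
      rw [op_succ, ← map_C_mul, ← map_C_mul, ← map_sub, ← map_sub]
      congr 1; ring
    rw [hexp]
    rcases (Nat.lt_succ_iff.1 hm).eq_or_lt with rfl | hmn
    · have h1 := recB_mul_sqNorm hL m
      have h2 : recA L m * L (op L (m - 1) * op L m) = 0 := by
        cases m with
        | zero => simp [recA]
        | succ m => rw [mul_comm (op L _), ih (m + 1) (by omega) (by omega), mul_zero]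
      rw [h2, show op L m * (X * op L m) = X * op L m * op L m by ring, ← h1]
      simp [sqNorm]
    · rw [hlow _ (op_degree_lt L hmn), X_mul_op, mul_add, mul_add, map_add, map_add]
      have h3 : L (op L n * (C (recB L m) * op L m)) = 0 := by
        rw [mul_left_comm, map_C_mul, hlow _ (op_degree_lt L hmn), mul_zero]
      have h4 : L (op L n * (C (recA L m) * op L (m - 1))) = 0 := by
        rw [mul_left_comm, map_C_mul, hlow _ (op_degree_lt L (by omega)), mul_zero]
      rw [h3, h4]
      obtain ⟨n, rfl⟩ : ∃ k, n = k + 1 := ⟨n - 1, by omega⟩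
      rcases (Nat.lt_succ_iff.1 hmn).eq_or_lt with rfl | hmn'
      · have := recA_succ_mul_sqNorm hL m
        simp only [sqNorm, Nat.add_sub_cancel] at this ⊢
        rw [this]; ring
      · rw [hlow _ (op_degree_lt L (by omega)), Nat.add_sub_cancel, ih n (by omega) hmn']
        ring

/-- Pairing with `op L n` kills polynomials of smaller degree. -/
lemma pairing_eq_zero {n : ℕ} {p : ℝ[X]} (hp : p.degree < n) : L (op L n * p) = 0 :=
  pairing_eq_zero_of_orthogonal (fun _ hm => op_orthogonal hL hm) le_rfl hp

lemma pairing_eq_coeff {n : ℕ} {p : ℝ[X]} (hp : p.degree < (n + 1 : ℕ)) :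
    L (op L n * p) = p.coeff n * sqNorm L n := by
  have h1 := pairing_eq_zero hL (degree_sub_op_lt (L := L) hp)
  have h2 : op L n * p = op L n * (p - C (p.coeff n) * op L n)
      + C (p.coeff n) * (op L n * op L n) := by ring
  rw [h2, map_add, h1, map_C_mul, zero_add, sqNorm]

/-- Pairing `P_n` with a polynomial of degree at most `n + 1` only sees its two top
coefficients. -/
lemma pairing_eq_coeff_add {n : ℕ} {p : ℝ[X]} (hp : p.degree < (n + 2 : ℕ)) :
    L (op L n * p) = (p.coeff n + sumB L (n + 1) * p.coeff (n + 1)) * sqNorm L n := by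
  have h1 := pairing_eq_coeff hL (degree_sub_op_lt (L := L) hp)
  have h2 : op L n * p = op L n * (p - C (p.coeff (n + 1)) * op L (n + 1))
      + C (p.coeff (n + 1)) * (op L (n + 1) * op L n) := by ring
  rw [h2, map_add, h1, map_C_mul, op_orthogonal hL (Nat.lt_succ_self n), coeff_sub, coeff_C_mul,
    op_succ_coeff]
  ring

end

/-! ### Top coefficients of shifted polynomials -/

section taylor

lemma taylor_coeff_of_natDegree_le {p : ℝ[X]} {m : ℕ} (hp : p.natDegree ≤ m + 2) (r : ℝ) :
    (taylor r p).coeff m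
      = p.coeff m + (m + 1) * r * p.coeff (m + 1)
        + (m + 2) * (m + 1) / 2 * r ^ 2 * p.coeff (m + 2) := by
  have hd : (hasseDeriv m p).natDegree < 3 := by
    have := natDegree_hasseDeriv_le p m
    omega
  rw [taylor_coeff, eval_eq_sum_range' hd]
  simp only [Finset.sum_range_succ, Finset.sum_range_zero, hasseDeriv_coeff]
  have h2 : ((Nat.choose (2 + m) m : ℕ) : ℝ) = (m + 2) * (m + 1) / 2 := by
    rw [show (2 + m).choose m = (m + 2).choose 2 by rw [add_comm, ← Nat.choose_symm_add]]
    rw [Nat.cast_choose_two]; push_cast; ring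
  have h1 : ((Nat.choose (1 + m) m : ℕ) : ℝ) = m + 1 := by
    rw [add_comm, Nat.choose_succ_self_right]; push_cast; ring
  rw [h1, h2, add_comm 1 m, add_comm 2 m]
  simp
  ring

variable {p : ℝ[X]} {n : ℕ} (hp : p.natDegree ≤ n) (r : ℝ)
include hp

lemma X_mul_taylor_sub_coeff : (X * (taylor r p - p)).coeff n = n * r * p.coeff n := by
  cases n with
  | zero => simp
  | succ m =>
    rw [coeff_X_mul, coeff_sub, taylor_coeff_of_natDegree_le (by omega),
      coeff_eq_zero_of_natDegree_lt (show p.natDegree < m + 2 by omega)]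
    push_cast; ring

lemma X_mul_X_mul_taylor_sub_coeff :
    (X * (X * (taylor r p - p))).coeff n
      = (n - 1) * r * (X * p).coeff n + n * (n - 1) / 2 * r ^ 2 * p.coeff n := by
  rcases n with - | - | m
  · simp
  · simp
  · rw [coeff_X_mul, coeff_X_mul, coeff_X_mul, coeff_sub, taylor_coeff_of_natDegree_le hp]
    push_cast; ring

lemma taylor_sub_coeff_of_le {m : ℕ} (hm : n ≤ m) : (taylor r p - p).coeff m = 0 := by
  rw [coeff_sub, taylor_coeff_of_natDegree_le (by omega),
    coeff_eq_zero_of_natDegree_lt (show p.natDegree < m + 1 by omega),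
    coeff_eq_zero_of_natDegree_lt (show p.natDegree < m + 2 by omega)]
  ring

end taylor

/-! ### Relations between the recurrence coefficients -/

section
variable {L : ℝ[X] →ₗ[ℝ] ℝ} {α β z : ℝ}

lemma taylor_mul_taylor_neg (p q : ℝ[X]) :
    taylor 1 (p * taylor (-1) q) = taylor 1 p * q := by
  rw [taylor_mul, taylor_taylor]; simp

lemma X_add_C_mul_coeff (p : ℝ[X]) (c : ℝ) (m : ℕ) :
    ((X + C c) * p).coeff m = (X * p).coeff m + c * p.coeff m := by
  rw [add_mul, coeff_add, coeff_C_mul]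

lemma X_add_C_mul_coeff_eq_zero {p : ℝ[X]} {n : ℕ} (hp : ∀ m, n ≤ m → p.coeff m = 0) (c : ℝ) :
    ∀ m, n + 1 ≤ m → ((X + C c) * p).coeff m = 0 := by
  intro m hm
  obtain ⟨m, rfl⟩ : ∃ k, m = k + 1 := ⟨m - 1, by omega⟩
  rw [X_add_C_mul_coeff, coeff_X_mul, hp m (by omega), hp (m + 1) (by omega)]
  ring

/-- The two top coefficients of `P_n(x + r) - P_n(x)`, which has degree at most `n - 1`; the
factors `X` keep the indices free of truncated subtraction. -/
lemma op_taylor_sub_coeff (L : ℝ[X] →ₗ[ℝ] ℝ) (n : ℕ) (r : ℝ) :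
    (X * (taylor r (op L n) - op L n)).coeff n = n * r ∧
    (X * (X * (taylor r (op L n) - op L n))).coeff n
      = -((n - 1) * r * sumB L n) + n * (n - 1) / 2 * r ^ 2 ∧
    ∀ m, n ≤ m → (taylor r (op L n) - op L n).coeff m = 0 := by
  refine ⟨?_, ?_, fun m hm => taylor_sub_coeff_of_le (op_natDegree_le L n) r hm⟩
  · rw [X_mul_taylor_sub_coeff (op_natDegree_le L n), op_coeff_self]; ring
  · rw [X_mul_X_mul_taylor_sub_coeff (op_natDegree_le L n), op_coeff_self, X_mul_op_coeff]; ring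

variable (hL : ∀ p : ℝ[X], p ≠ 0 → 0 < L (p * p))
include hL

lemma pairing_op_X_mul_op (n : ℕ) : L (op L n * (X * op L n)) = recB L n * sqNorm L n := by
  rw [recB_mul_sqNorm hL]; congr 1; ring

lemma pairing_op_succ_X_mul_op (n : ℕ) : L (op L (n + 1) * (X * op L n)) = sqNorm L (n + 1) := by
  rw [pairing_eq_coeff hL, coeff_X_mul, op_coeff_self, one_mul]
  rw [degree_lt_iff_coeff_zero]
  intro m hm
  obtain ⟨m, rfl⟩ : ∃ k, m = k + 1 := ⟨m - 1, by omega⟩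
  rw [coeff_X_mul, op_coeff_of_lt L (by omega)]

lemma pairing_op_X_mul_X_mul_op (n : ℕ) :
    L (op L n * (X * (X * op L n)))
      = (recA L (n + 1) + recB L n ^ 2 + recA L n) * sqNorm L n := by
  have h1 : L (op L n * (X * (X * op L n)))
      = L (op L (n + 1) * (X * op L n)) + recB L n * L (op L n * (X * op L n))
        + recA L n * L (op L n * (X * op L (n - 1))) := by
    rw [← map_C_mul, ← map_C_mul, ← map_add, ← map_add]
    congr 1
    linear_combination X * op L n * X_mul_op L n
  have h2 : recA L n * L (op L n * (X * op L (n - 1))) = recA L n * sqNorm L n := by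
    cases n with
    | zero => simp [recA]
    | succ n => rw [Nat.add_sub_cancel, pairing_op_succ_X_mul_op hL]
  rw [h1, h2, pairing_op_X_mul_op hL, pairing_op_succ_X_mul_op hL, ← recA_succ_mul_sqNorm hL]
  ring

-- The Pearson equation of the weight, as a property of its moment functional.
variable (hP : ∀ p : ℝ[X], L (X * (X + C (β - 1)) * p) = z * L ((X + C α) * taylor 1 p))
include hP

/-- Obtained from the Pearson equation for `P_n(x) P_n(x - 1)`: both sides only involve the top
coefficients of `P_n(x ± 1) - P_n(x)`. -/
lemma quadratic_relation (n : ℕ) :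
    recA L (n + 1) + recA L n + recB L n ^ 2 + (β - 1 - n) * recB L n - n * (β - 1)
      + n * (n - 1) / 2 - sumB L n = z * (recB L n + n + α) := by
  have hne := (sqNorm_pos hL n).ne'
  obtain ⟨e1, e2, e3⟩ := op_taylor_sub_coeff L n (-1)
  obtain ⟨d1, d2, d3⟩ := op_taylor_sub_coeff L n 1
  set e := taylor (-1) (op L n) - op L n with he
  set d := taylor 1 (op L n) - op L n with hd
  have h := hP (op L n * taylor (-1) (op L n))
  rw [taylor_mul_taylor_neg] at h
  have hl : L (X * (X + C (β - 1)) * (op L n * taylor (-1) (op L n)))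
      = L (op L n * (X * (X * op L n))) + (β - 1) * L (op L n * (X * op L n))
        + L (op L n * ((X + C (β - 1)) * ((X + C 0) * e))) := by
    rw [← map_C_mul, ← map_add, ← map_add, he]
    congr 1; simp only [C_0]; ring
  have hr : L ((X + C α) * (taylor 1 (op L n) * op L n))
      = L (op L n * (X * op L n)) + α * sqNorm L n + L (op L n * ((X + C α) * d)) := by
    rw [sqNorm, ← map_C_mul, ← map_add, ← map_add, hd]
    congr 1; ring
  have he' : L (op L n * ((X + C (β - 1)) * ((X + C 0) * e)))
      = (((n - 1) * sumB L n + n * (n - 1) / 2 - (β - 1) * n) + sumB L (n + 1) * (-n))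
        * sqNorm L n := by
    rw [pairing_eq_coeff_add hL]
    · have c1 : ((X + C (β - 1)) * ((X + C 0) * e)).coeff n
          = (n - 1) * sumB L n + n * (n - 1) / 2 - (β - 1) * n := by
        rw [X_add_C_mul_coeff, C_0, add_zero, e1, e2]; ring
      have c2 : ((X + C (β - 1)) * ((X + C 0) * e)).coeff (n + 1) = -(n : ℝ) := by
        rw [X_add_C_mul_coeff, C_0, add_zero, coeff_X_mul, coeff_X_mul, e1,
          e3 n le_rfl]; ring
      rw [c1, c2]
    · exact (degree_lt_iff_coeff_zero _ _).2
        (X_add_C_mul_coeff_eq_zero (X_add_C_mul_coeff_eq_zero e3 0) _)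
  have hd' : L (op L n * ((X + C α) * d)) = n * sqNorm L n := by
    rw [pairing_eq_coeff hL, X_add_C_mul_coeff, d1, d3 n le_rfl]
    · ring
    · exact (degree_lt_iff_coeff_zero _ _).2 (X_add_C_mul_coeff_eq_zero d3 _)
  rw [hl, hr, he', hd', pairing_op_X_mul_X_mul_op hL, pairing_op_X_mul_op hL, sumB_succ] at h
  apply mul_right_cancel₀ hne
  linear_combination h

/-- Obtained from the Pearson equation for `P_{n+1}(x) P_n(x - 1)`. It is linear in each of `b_n`,
`b_{n+1}` and `s_{n+1}`. -/
lemma linear_relation (n : ℕ) :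
    recA L (n + 1) * (recB L (n + 1) + recB L n + β - (n + 1))
      = z * (recA L (n + 1) + (n + 1) * α + (n + 1) * n / 2 + sumB L (n + 1)) := by
  have hne := (sqNorm_pos hL n).ne'
  have ha := recA_succ_mul_sqNorm hL n
  obtain ⟨e1, e2, e3⟩ := op_taylor_sub_coeff L n (-1)
  obtain ⟨d1, d2, d3⟩ := op_taylor_sub_coeff L (n + 1) 1
  set e := taylor (-1) (op L n) - op L n with he
  set d := taylor 1 (op L (n + 1)) - op L (n + 1) with hd
  have h := hP (op L (n + 1) * taylor (-1) (op L n))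
  rw [taylor_mul_taylor_neg] at h
  have hop : ∀ m, n + 1 ≤ m → (op L n).coeff m = 0 := fun m hm => op_coeff_of_lt L hm
  have hl : L (X * (X + C (β - 1)) * (op L (n + 1) * taylor (-1) (op L n)))
      = L (op L (n + 1) * ((X + C (β - 1)) * ((X + C 0) * op L n)))
        + L (op L (n + 1) * ((X + C (β - 1)) * ((X + C 0) * e))) := by
    rw [← map_add, he]
    congr 1; simp only [C_0]; ring
  have hr : L ((X + C α) * (taylor 1 (op L (n + 1)) * op L n))
      = L (op L (n + 1) * (X * op L n)) + α * L (op L (n + 1) * op L n)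
        + L (op L n * ((X + C α) * d)) := by
    rw [← map_C_mul, ← map_add, ← map_add, hd]
    congr 1; ring
  have h1 : L (op L (n + 1) * ((X + C (β - 1)) * ((X + C 0) * op L n)))
      = (-sumB L n + (β - 1) + sumB L (n + 2)) * sqNorm L (n + 1) := by
    rw [pairing_eq_coeff_add hL]
    · rw [X_add_C_mul_coeff, C_0, add_zero, coeff_X_mul, coeff_X_mul, X_mul_op_coeff,
        op_coeff_self, X_add_C_mul_coeff, coeff_X_mul, coeff_X_mul, coeff_X_mul, op_coeff_self,
        op_coeff_of_lt L (Nat.lt_succ_self n)]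
      ring
    · exact (degree_lt_iff_coeff_zero _ _).2
        (X_add_C_mul_coeff_eq_zero (X_add_C_mul_coeff_eq_zero hop 0) _)
  have h2 : L (op L (n + 1) * ((X + C (β - 1)) * ((X + C 0) * e))) = -n * sqNorm L (n + 1) := by
    rw [pairing_eq_coeff hL]
    · rw [X_add_C_mul_coeff, C_0, add_zero, coeff_X_mul, coeff_X_mul, e1,
        e3 n le_rfl]
      ring
    · exact (degree_lt_iff_coeff_zero _ _).2
        (X_add_C_mul_coeff_eq_zero (X_add_C_mul_coeff_eq_zero e3 0) _)
  have h3 : L (op L n * ((X + C α) * d))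
      = (-(n * sumB L (n + 1)) + (n + 1) * n / 2 + α * (n + 1)
          + sumB L (n + 1) * (n + 1)) * sqNorm L n := by
    rw [coeff_X_mul] at d1
    rw [coeff_X_mul] at d2
    rw [pairing_eq_coeff_add hL]
    · rw [X_add_C_mul_coeff, d1, d2, X_add_C_mul_coeff, coeff_X_mul, d1,
        d3 (n + 1) le_rfl]
      push_cast; ring
    · exact (degree_lt_iff_coeff_zero _ _).2 (X_add_C_mul_coeff_eq_zero d3 _)
  rw [hl, hr, h1, h2, h3, pairing_op_succ_X_mul_op hL, op_orthogonal hL (Nat.lt_succ_self n),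
    sumB_succ, sumB_succ, ← ha] at h
  apply mul_right_cancel₀ hne
  rw [sumB_succ]
  linear_combination h

/-- A first integral of the two previous relations: the difference of the two sides does not depend
on `n`, and it vanishes formally at `n = -1`, where `a_0 = s_0 = 0`. -/
lemma factorized_relation (n : ℕ) :
    recA L (n + 1) * (n + 1 + z - recB L (n + 1)) * (n + z - recB L n)
      = (recA L (n + 1) - z * (n + 1 + α - β)) * (recA L (n + 1) - sumB L (n + 1) + (n + 1) * n / 2)
    := by
  induction n with
  | zero =>
    have hq := quadratic_relation hL hP 0
    have hl := linear_relation hL hP 0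
    have h0 : sumB L 0 = 0 := rfl
    rw [sumB_succ, h0] at hl ⊢
    rw [h0] at hq
    simp only [recA, Nat.cast_zero] at hq hl ⊢
    linear_combination (z - recB L 0) * (-hl) + (z - sqNorm L (0 + 1) / sqNorm L 0) * hq
  | succ n ih =>
    have hq := quadratic_relation hL hP (n + 1)
    have hl := linear_relation hL hP n
    have hl' := linear_relation hL hP (n + 1)
    rw [sumB_succ L (n + 1)] at hl' ⊢
    push_cast at hq hl' ⊢
    linear_combination ih + (n + 1 + z - recB L (n + 1)) * (hl - hl')
      + (z - recA L (n + 2) + recA L (n + 1)) * hq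

end

/-! ### Moment functionals and Hankel determinants -/

noncomputable section

/-- The linear functional on polynomials with `X ^ j ↦ μ j`. -/
def momentFunctional (μ : ℕ → ℝ) : ℝ[X] →ₗ[ℝ] ℝ := lsum fun i => μ i • LinearMap.id

lemma momentFunctional_monomial (μ : ℕ → ℝ) (i : ℕ) (c : ℝ) :
    momentFunctional μ (monomial i c) = μ i * c := by
  simp [momentFunctional, lsum_apply, sum_monomial_index]

lemma momentFunctional_eq_sum (μ : ℕ → ℝ) {p : ℝ[X]} {N : ℕ} (hp : p.natDegree < N) :
    momentFunctional μ p = ∑ i ∈ Finset.range N, μ i * p.coeff i := by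
  conv_lhs => rw [p.as_sum_range' N hp, map_sum]
  simp [momentFunctional_monomial]

/-- The Hankel matrix `H` of the moments and the unitriangular matrix `T` of the coefficients of the
orthogonal polynomials satisfy `T H Tᵀ = diag (h_0, …, h_{n-1})`. -/
lemma det_hankel_eq_prod {μ : ℕ → ℝ}
    (hL : ∀ p : ℝ[X], p ≠ 0 → 0 < momentFunctional μ (p * p)) (n : ℕ) :
    Matrix.det (Matrix.of fun i j : Fin n => μ ((i : ℕ) + (j : ℕ)))
      = ∏ k ∈ Finset.range n, sqNorm (momentFunctional μ) k := by
  set L := momentFunctional μ with hLdef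
  set H : Matrix (Fin n) (Fin n) ℝ := Matrix.of fun i j : Fin n => μ ((i : ℕ) + (j : ℕ))
  let T : Matrix (Fin n) (Fin n) ℝ := Matrix.of fun k i : Fin n => (op L k).coeff i
  have hT : T.det = 1 := by
    rw [Matrix.det_of_isLowerTriangular]
    · exact Finset.prod_eq_one fun i _ => op_coeff_self L i
    · intro i j hij
      exact op_coeff_of_lt L hij
  have hexp : ∀ k : Fin n, op L k = ∑ i : Fin n, monomial (i : ℕ) ((op L k).coeff i) := by
    intro k
    conv_lhs => rw [(op L k).as_sum_range' n ((op_natDegree_le L k).trans_lt k.2)]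
    rw [Finset.sum_range]
  have hG : T * H * T.transpose = Matrix.diagonal fun k : Fin n => sqNorm L k := by
    ext k l
    have h1 : L (op L k * op L l) = (T * H * T.transpose) k l := by
      rw [hexp k, hexp l, Finset.sum_mul_sum, map_sum, Matrix.mul_apply]
      simp only [Matrix.mul_apply, Matrix.transpose_apply, Finset.sum_mul, map_sum]
      rw [Finset.sum_comm]
      refine Finset.sum_congr rfl fun j _ => Finset.sum_congr rfl fun i _ => ?_
      rw [monomial_mul_monomial, hLdef, momentFunctional_monomial]
      simp only [T, H, Matrix.of_apply]
      ring
    rw [← h1]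
    rcases lt_trichotomy k l with h | rfl | h
    · rw [mul_comm, op_orthogonal hL h, Matrix.diagonal_apply_ne _ h.ne]
    · rw [Matrix.diagonal_apply_eq, sqNorm]
    · rw [op_orthogonal hL h, Matrix.diagonal_apply_ne _ h.ne']
  have := congrArg Matrix.det hG
  rw [Matrix.det_mul, Matrix.det_mul, Matrix.det_transpose, hT, Matrix.det_diagonal] at this
  rw [Finset.prod_range, ← this]; ring

/-! ### Dependence on the parameter: the Toda equations -/

/-- The family `p` of polynomials has coefficientwise derivative `p'` at the parameter `z`. -/
def HasCoeffDerivAt (p : ℝ → ℝ[X]) (p' : ℝ[X]) (z : ℝ) : Prop :=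
  ∀ i, HasDerivAt (fun w => (p w).coeff i) (p'.coeff i) z

section deriv
variable {p q : ℝ → ℝ[X]} {p' q' : ℝ[X]} {z : ℝ}

lemma HasCoeffDerivAt.sub (hp : HasCoeffDerivAt p p' z) (hq : HasCoeffDerivAt q q' z) :
    HasCoeffDerivAt (fun w => p w - q w) (p' - q') z := fun i => by
  simpa only [coeff_sub] using (hp i).fun_sub (hq i)

lemma HasCoeffDerivAt.mul (hp : HasCoeffDerivAt p p' z) (hq : HasCoeffDerivAt q q' z) :
    HasCoeffDerivAt (fun w => p w * q w) (p' * q z + p z * q') z := fun i => by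
  simp only [coeff_add, coeff_mul, ← Finset.sum_add_distrib]
  exact HasDerivAt.fun_sum fun x _ => (hp x.1).fun_mul (hq x.2)

lemma hasCoeffDerivAt_const (p : ℝ[X]) (z : ℝ) : HasCoeffDerivAt (fun _ => p) 0 z := fun i => by
  simpa using hasDerivAt_const z (p.coeff i)

lemma hasCoeffDerivAt_C {f : ℝ → ℝ} {f' : ℝ} (hf : HasDerivAt f f' z) :
    HasCoeffDerivAt (fun w => C (f w)) (C f') z := fun i => by
  simp only [coeff_C]
  split_ifs
  · exact hf
  · exact hasDerivAt_const _ _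

variable {μ : ℝ → ℕ → ℝ}

/-- If the moments satisfy `z dμ_j/dz = μ_{j+1}`, then differentiating the functional with respect
to the parameter amounts to inserting `X / z`. -/
lemma hasDerivAt_momentFunctional (hμ : ∀ j, HasDerivAt (fun w => μ w j) (μ z (j + 1) / z) z)
    (hp : HasCoeffDerivAt p p' z) {N : ℕ} (hN : ∀ w, (p w).natDegree < N) :
    HasDerivAt (fun w => momentFunctional (μ w) (p w))
      (momentFunctional (μ z) (X * p z) / z + momentFunctional (μ z) p') z := by
  have hN' : p'.natDegree < N := by
    rcases N with - | N
    · exact absurd (hN 0) (by omega)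
    · refine Nat.lt_succ_iff.2 (natDegree_le_iff_coeff_eq_zero.2 fun i hi => ?_)
      have h0 : (fun w => (p w).coeff i) = fun _ => 0 :=
        funext fun w => coeff_eq_zero_of_natDegree_lt ((hN w).trans_le hi)
      have h1 := hp i
      rw [h0] at h1
      exact h1.unique (hasDerivAt_const z 0)
  have hX : (X * p z).natDegree < N + 1 := by
    have := natDegree_mul_le (p := X) (q := p z)
    have := hN z
    simp at *; omega
  have h : HasDerivAt (fun w => ∑ i ∈ Finset.range N, μ w i * (p w).coeff i)
      (∑ i ∈ Finset.range N, (μ z (i + 1) / z * (p z).coeff i + μ z i * p'.coeff i)) z :=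
    HasDerivAt.fun_sum fun i _ => (hμ i).fun_mul (hp i)
  simp only [fun w => momentFunctional_eq_sum (μ w) (hN w), momentFunctional_eq_sum _ hN',
    momentFunctional_eq_sum _ hX]
  convert h using 1
  rw [Finset.sum_range_succ', Finset.sum_add_distrib, coeff_X_mul_zero, mul_zero, add_zero,
    Finset.sum_div]
  simp only [coeff_X_mul]
  congr 1
  exact Finset.sum_congr rfl fun i _ => by ring

end deriv

section toda
variable {μ : ℝ → ℕ → ℝ} {U : Set ℝ} (hU : IsOpen U)
  (hμ : ∀ z ∈ U, ∀ j, HasDerivAt (fun w => μ w j) (μ z (j + 1) / z) z)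
  (hL : ∀ z ∈ U, ∀ p : ℝ[X], p ≠ 0 → 0 < momentFunctional (μ z) (p * p))
  {z : ℝ} (hz : z ∈ U)
include hμ hL hz

lemma exists_hasCoeffDerivAt_op (n : ℕ) :
    ∃ P', HasCoeffDerivAt (fun w => op (momentFunctional (μ w)) n) P' z := by
  induction n using Nat.strong_induction_on with
  | _ n ih =>
    have hnorm : ∀ m < n, DifferentiableAt ℝ (fun w => sqNorm (momentFunctional (μ w)) m) z := by
      intro m hm
      obtain ⟨P', hP'⟩ := ih m hm
      refine (hasDerivAt_momentFunctional (hμ z hz) (hP'.mul hP') (N := m + m + 1)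
        fun w => ?_).differentiableAt
      have := natDegree_mul_le (p := op (momentFunctional (μ w)) m)
        (q := op (momentFunctional (μ w)) m)
      have := op_natDegree_le (momentFunctional (μ w)) m
      omega
    rcases n with - | n
    · exact ⟨0, hasCoeffDerivAt_const 1 z⟩
    · obtain ⟨P', hP'⟩ := ih n (by omega)
      obtain ⟨Q', hQ'⟩ := ih (n - 1) (by omega)
      have hb : DifferentiableAt ℝ (fun w => recB (momentFunctional (μ w)) n) z := by
        refine DifferentiableAt.fun_div (hasDerivAt_momentFunctional (hμ z hz)
          (((hasCoeffDerivAt_const X z).mul hP').mul hP') (N := 1 + n + n + 1)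
          fun w => ?_).differentiableAt (hnorm n (by omega)) (sqNorm_pos (hL z hz) n).ne'
        have h1 := natDegree_mul_le (p := X * op (momentFunctional (μ w)) n)
          (q := op (momentFunctional (μ w)) n)
        have h2 := natDegree_mul_le (p := X) (q := op (momentFunctional (μ w)) n)
        have h3 := op_natDegree_le (momentFunctional (μ w)) n
        rw [natDegree_X] at h2
        omega
      have ha : DifferentiableAt ℝ (fun w => recA (momentFunctional (μ w)) n) z := by
        rcases n with - | n
        · exact differentiableAt_const _
        · exact (hnorm (n + 1) (by omega)).fun_div (hnorm n (by omega))
            (sqNorm_pos (hL z hz) n).ne'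
      simp only [op_succ]
      exact ⟨_, (((hasCoeffDerivAt_const X z).sub (hasCoeffDerivAt_C hb.hasDerivAt)).mul hP').sub
        ((hasCoeffDerivAt_C ha.hasDerivAt).mul hQ')⟩

/-- As `P_n` is monic of degree `n` for every parameter, its derivative has smaller degree. -/
lemma exists_hasCoeffDerivAt_op_degree_lt (n : ℕ) :
    ∃ P', HasCoeffDerivAt (fun w => op (momentFunctional (μ w)) n) P' z ∧ P'.degree < n := by
  obtain ⟨P', hP'⟩ := exists_hasCoeffDerivAt_op hμ hL hz n
  refine ⟨P', hP', (degree_lt_iff_coeff_zero _ _).2 fun m hm => ?_⟩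
  refine (hP' m).unique ?_
  rcases hm.eq_or_lt with rfl | h
  · simpa only [op_coeff_self] using hasDerivAt_const z (1 : ℝ)
  · simpa only [op_coeff_of_lt _ h] using hasDerivAt_const z (0 : ℝ)

/-- The Toda equation `z dh_n/dz = b_n h_n`. -/
lemma hasDerivAt_sqNorm (n : ℕ) :
    HasDerivAt (fun w => sqNorm (momentFunctional (μ w)) n)
      (recB (momentFunctional (μ z)) n * sqNorm (momentFunctional (μ z)) n / z) z := by
  obtain ⟨P', hP', hd⟩ := exists_hasCoeffDerivAt_op_degree_lt hμ hL hz n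
  have h := hasDerivAt_momentFunctional (hμ z hz) (hP'.mul hP') (N := n + n + 1) fun w => by
    have := natDegree_mul_le (p := op (momentFunctional (μ w)) n)
      (q := op (momentFunctional (μ w)) n)
    have := op_natDegree_le (momentFunctional (μ w)) n
    omega
  refine HasDerivAt.congr_deriv (f := fun w => sqNorm (momentFunctional (μ w)) n) h ?_
  rw [map_add, mul_comm P', pairing_eq_zero (hL z hz) hd, recB_mul_sqNorm (hL z hz), mul_assoc]
  ring

/-- The Toda equation `z da_n/dz = a_n (b_n - b_{n-1})`. -/
lemma hasDerivAt_recA_succ (n : ℕ) :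
    HasDerivAt (fun w => recA (momentFunctional (μ w)) (n + 1))
      (recA (momentFunctional (μ z)) (n + 1) * (recB (momentFunctional (μ z)) (n + 1)
        - recB (momentFunctional (μ z)) n) / z) z := by
  have hne := (sqNorm_pos (hL z hz) n).ne'
  refine ((hasDerivAt_sqNorm hμ hL hz (n + 1)).fun_div
    (hasDerivAt_sqNorm hμ hL hz n) hne).congr_deriv ?_
  simp only [recA]
  field_simp

include hU

/-- The Toda equation `z ds_n/dz = a_n`, obtained by differentiating `L (P_{n+1} P_n) = 0`. -/
lemma hasDerivAt_sumB (n : ℕ) :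
    HasDerivAt (fun w => sumB (momentFunctional (μ w)) n) (recA (momentFunctional (μ z)) n / z)
      z := by
  rcases n with - | n
  · simpa [sumB, recA] using hasDerivAt_const z (0 : ℝ)
  obtain ⟨P', hP', hPd⟩ := exists_hasCoeffDerivAt_op_degree_lt hμ hL hz (n + 1)
  obtain ⟨Q', hQ', hQd⟩ := exists_hasCoeffDerivAt_op_degree_lt hμ hL hz n
  have h := hasDerivAt_momentFunctional (hμ z hz) (hP'.mul hQ') (N := n + 1 + n + 1) fun w => by
    have := natDegree_mul_le (p := op (momentFunctional (μ w)) (n + 1))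
      (q := op (momentFunctional (μ w)) n)
    have := op_natDegree_le (momentFunctional (μ w)) n
    have := op_natDegree_le (momentFunctional (μ w)) (n + 1)
    omega
  have h0 : (fun w => momentFunctional (μ w)
      (op (momentFunctional (μ w)) (n + 1) * op (momentFunctional (μ w)) n)) =ᶠ[𝓝 z]
      fun _ => 0 := by
    filter_upwards [hU.mem_nhds hz] with w hw
    exact op_orthogonal (hL w hw) (Nat.lt_succ_self n)
  have h1 := (h.congr_of_eventuallyEq h0.symm).unique (hasDerivAt_const z (0 : ℝ))
  have hne := (sqNorm_pos (hL z hz) n).ne'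
  have hQd' : Q'.degree < (n + 1 : ℕ) := hQd.trans (by exact_mod_cast Nat.lt_succ_self n)
  rw [map_add, mul_comm P', pairing_eq_coeff (hL z hz) hPd, pairing_eq_zero (hL z hz) hQd',
    mul_left_comm, pairing_op_succ_X_mul_op (hL z hz), ← recA_succ_mul_sqNorm (hL z hz)] at h1
  -- Monicity and `P_{n+1} = X ^ (n + 1) - s_{n+1} X ^ n + ⋯` make this coefficient `-s_{n+1}'`.
  have h2 : P'.coeff n = -(recA (momentFunctional (μ z)) (n + 1) / z) := by
    apply mul_right_cancel₀ hne
    linear_combination h1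
  have h3 := (hP' n).fun_neg
  simp only [op_succ_coeff, neg_neg, h2] at h3
  exact h3

end toda
end

/-! ### The generalized Meixner weight and its moments -/

lemma poch_succ (a : ℝ) (k : ℕ) : poch a (k + 1) = poch a k * (a + k) :=
  ascPochhammer_succ_eval k a

lemma poch_pos {a : ℝ} (ha : 0 < a) (k : ℕ) : 0 < poch a k := ascPochhammer_pos k a ha

section weight
variable {α β z : ℝ}

lemma weight_pos (hα : 0 < α) (hβ : 0 < β) (hz : 0 < z) (k : ℕ) : 0 < weight α β z k := by
  have := poch_pos hα k
  have := poch_pos hβ k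
  unfold weight
  positivity

/-- The Pearson equation of the weight: its consecutive values have a rational quotient. -/
lemma weight_succ (hβ : 0 < β) (k : ℕ) :
    (k + 1) * (β + k) * weight α β z (k + 1) = z * (α + k) * weight α β z k := by
  have h1 := (poch_pos hβ k).ne'
  have h2 : β + k ≠ 0 := by positivity
  rw [weight, weight, poch_succ, poch_succ, Nat.factorial_succ]
  push_cast
  field_simp
  ring

lemma poch_le (hα : 0 < α) (hβ : 0 < β) (k : ℕ) : poch α k ≤ (1 + α / β) ^ k * poch β k := by
  induction k with
  | zero => simp [poch]
  | succ k ih =>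
    have h : α + k ≤ (1 + α / β) * (β + k) := by
      have : (1 + α / β) * (β + k) = α + k + β + α / β * k := by field_simp; ring
      rw [this]
      have : 0 ≤ α / β * k := by positivity
      linarith
    have := poch_pos hα k
    have := poch_pos hβ k
    calc poch α (k + 1) = poch α k * (α + k) := poch_succ α k
      _ ≤ ((1 + α / β) ^ k * poch β k) * ((1 + α / β) * (β + k)) := by gcongr
      _ = (1 + α / β) ^ (k + 1) * poch β (k + 1) := by rw [poch_succ]; ring

lemma summable_pow_mul_weight (hα : 0 < α) (hβ : 0 < β) (hz : 0 < z) (j : ℕ) :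
    Summable fun k : ℕ => (k : ℝ) ^ j * weight α β z k := by
  refine Summable.of_nonneg_of_le
    (fun k => mul_nonneg (by positivity) (weight_pos hα hβ hz k).le) (fun k => ?_)
    ((Real.summable_pow_div_factorial (Real.exp 1 * ((1 + α / β) * z))).mul_left (j ! : ℝ))
  have h1 : (k : ℝ) ^ j ≤ (j ! : ℝ) * Real.exp 1 ^ k := by
    have := Real.pow_div_factorial_le_exp (k : ℝ) (Nat.cast_nonneg k) j
    rw [div_le_iff₀ (by positivity)] at this
    rw [← Real.exp_nat_mul, mul_one, mul_comm]
    exact this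
  have h2 : weight α β z k ≤ ((1 + α / β) * z) ^ k / (k ! : ℝ) := by
    have hb := poch_pos hβ k
    rw [weight, mul_pow, div_le_div_iff₀ (by positivity) (by positivity)]
    have := mul_le_mul_of_nonneg_right (poch_le hα hβ k) (by positivity : 0 ≤ z ^ k * (k ! : ℝ))
    linarith
  calc (k : ℝ) ^ j * weight α β z k
      ≤ ((j ! : ℝ) * Real.exp 1 ^ k) * (((1 + α / β) * z) ^ k / (k ! : ℝ)) :=
        mul_le_mul h1 h2 (weight_pos hα hβ hz k).le (by positivity)
    _ = (j ! : ℝ) * ((Real.exp 1 * ((1 + α / β) * z)) ^ k / (k ! : ℝ)) := by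
        rw [mul_pow (Real.exp 1)]; ring

/-- Termwise differentiation, dominated on `(0, z + 1)` by the series at `z + 1`. -/
lemma hasDerivAt_moment (hα : 0 < α) (hβ : 0 < β) (hz : 0 < z) (j : ℕ) :
    HasDerivAt (fun w => moment α β w j) (moment α β z (j + 1) / z) z := by
  set R : ℝ := z + 1
  have hR : 0 < R := by positivity
  have hterm : ∀ k : ℕ, ∀ y ∈ Set.Ioo 0 R, HasDerivAt (fun w => (k : ℝ) ^ j * weight α β w k)
      ((k : ℝ) ^ (j + 1) * weight α β y k / y) y := by
    intro k y hy
    have hb := (poch_pos hβ k).ne'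
    have hy0 := hy.1.ne'
    have h := (((hasDerivAt_pow k y).const_mul (poch α k)).div_const
      (poch β k * (k ! : ℝ))).const_mul ((k : ℝ) ^ j)
    refine h.congr_deriv ?_
    rw [weight]
    rcases k with - | k
    · simp
    · rw [Nat.add_sub_cancel]
      field_simp
      ring
  have hbound : ∀ k : ℕ, ∀ y ∈ Set.Ioo 0 R, ‖(k : ℝ) ^ (j + 1) * weight α β y k / y‖
      ≤ (k : ℝ) ^ (j + 1) * weight α β R k / R := by
    intro k y hy
    have hy0 := hy.1
    have ha := poch_pos hα k
    have hb := poch_pos hβ k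
    rw [Real.norm_of_nonneg
      (div_nonneg (mul_nonneg (by positivity) (weight_pos hα hβ hy0 k).le) hy0.le)]
    rcases k with - | k
    · simp
    · have hfac : ∀ x : ℝ, 0 < x → ((k + 1 : ℕ) : ℝ) ^ (j + 1) * weight α β x (k + 1) / x
          = ((k + 1 : ℕ) : ℝ) ^ (j + 1) * poch α (k + 1) / (poch β (k + 1) * ((k + 1)! : ℝ))
            * x ^ k := by
        intro x hx
        rw [weight]
        field_simp
        ring
      rw [hfac y hy0, hfac R hR]
      have := hy.2.le
      gcongr
  have hmem : z ∈ Set.Ioo 0 R := ⟨hz, by simp [R]⟩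
  have h := hasDerivAt_tsum_of_isPreconnected
    ((summable_pow_mul_weight hα hβ hR (j + 1)).div_const R) isOpen_Ioo isPreconnected_Ioo hterm
    hbound hmem (summable_pow_mul_weight hα hβ hz j) hmem
  rw [tsum_div_const] at h
  exact h

lemma moment_zero : (fun w => moment α β w 0) = kummerM α β := by
  ext w
  refine tsum_congr fun k => ?_
  rw [weight]; ring

lemma iterate_eulerOp_kummerM (hα : 0 < α) (hβ : 0 < β) (j : ℕ) {z : ℝ} (hz : 0 < z) :
    (eulerOp^[j] (kummerM α β)) z = moment α β z j := by
  induction j generalizing z with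
  | zero => rw [← moment_zero]; rfl
  | succ j ih =>
    have he : eulerOp^[j] (kummerM α β) =ᶠ[𝓝 z] fun w => moment α β w j := by
      filter_upwards [lt_mem_nhds hz] with w hw using ih hw
    rw [Function.iterate_succ_apply', eulerOp, he.deriv_eq, (hasDerivAt_moment hα hβ hz j).deriv,
      mul_div_cancel₀ _ hz.ne']

lemma hankelDet_eq_wronskianDet (hα : 0 < α) (hβ : 0 < β) (hz : 0 < z) (n : ℕ) :
    hankelDet n α β z = wronskianDet n (kummerM α β) z := by
  simp only [hankelDet, wronskianDet, iterate_eulerOp_kummerM hα hβ _ hz]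

lemma hasSum_momentFunctional (hα : 0 < α) (hβ : 0 < β) (hz : 0 < z) (p : ℝ[X]) :
    HasSum (fun k : ℕ => p.eval (k : ℝ) * weight α β z k) (momentFunctional (moment α β z) p) := by
  induction p using Polynomial.induction_on' with
  | add p q hp hq =>
    simp only [eval_add, add_mul, map_add]
    exact hp.add hq
  | monomial j c =>
    simp only [eval_monomial, momentFunctional_monomial, mul_comm _ c, mul_assoc]
    exact (summable_pow_mul_weight hα hβ hz j).hasSum.mul_left c

lemma momentFunctional_mul_self_pos (hα : 0 < α) (hβ : 0 < β) (hz : 0 < z) {p : ℝ[X]}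
    (hp : p ≠ 0) : 0 < momentFunctional (moment α β z) (p * p) := by
  obtain ⟨k, hk⟩ : ∃ k : ℕ, p.eval (k : ℝ) ≠ 0 := by
    by_contra! hall
    refine hp (eq_zero_of_infinite_isRoot p
      ((Set.infinite_range_of_injective (Nat.cast_injective (R := ℝ))).mono ?_))
    rintro _ ⟨k, rfl⟩
    exact hall k
  have h := hasSum_momentFunctional hα hβ hz (p * p)
  rw [← h.tsum_eq]
  simp only [eval_mul] at h ⊢
  exact h.summable.tsum_pos
    (fun i => mul_nonneg (mul_self_nonneg _) (weight_pos hα hβ hz i).le) k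
    (mul_pos (mul_self_pos.2 hk) (weight_pos hα hβ hz k))

lemma momentFunctional_pearson (hα : 0 < α) (hβ : 0 < β) (hz : 0 < z) (p : ℝ[X]) :
    momentFunctional (moment α β z) (X * (X + C (β - 1)) * p)
      = z * momentFunctional (moment α β z) ((X + C α) * taylor 1 p) := by
  have h1 := (hasSum_nat_add_iff' 1).2 (hasSum_momentFunctional hα hβ hz (X * (X + C (β - 1)) * p))
  have h2 := (hasSum_momentFunctional hα hβ hz ((X + C α) * taylor 1 p)).mul_left z
  simp only [Finset.sum_range_one, eval_mul, eval_X, Nat.cast_zero, zero_mul, sub_zero] at h1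
  refine h1.unique ((congrArg (fun f : ℕ → ℝ => HasSum f _) (funext fun k => ?_)).mp h2)
  have h := weight_succ (α := α) (z := z) hβ k
  simp only [eval_mul, eval_add, eval_X, eval_C, taylor_eval]
  push_cast
  linear_combination -p.eval ((k : ℝ) + 1) * h

end weight

/-! ### The logarithmic derivative of the Hankel determinant -/

section logDeriv
variable {α β z : ℝ} (hα : 0 < α) (hβ : 0 < β) (n : ℕ) (hz : 0 < z)
include hα hβ hz

lemma wronskianDet_eq_prod : wronskianDet n (kummerM α β) z
    = ∏ k ∈ Finset.range n, sqNorm (momentFunctional (moment α β z)) k := by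
  rw [← hankelDet_eq_wronskianDet hα hβ hz]
  exact det_hankel_eq_prod (fun p hp => momentFunctional_mul_self_pos hα hβ hz hp) n

lemma wronskianDet_pos : 0 < wronskianDet n (kummerM α β) z := by
  rw [wronskianDet_eq_prod hα hβ n hz]
  exact Finset.prod_pos fun k _ =>
    sqNorm_pos (fun p hp => momentFunctional_mul_self_pos hα hβ hz hp) k

lemma wronskianDet_eventuallyEq : wronskianDet n (kummerM α β)
    =ᶠ[𝓝 z] fun w => ∏ k ∈ Finset.range n, sqNorm (momentFunctional (moment α β w)) k := by
  filter_upwards [lt_mem_nhds hz] with w hw using wronskianDet_eq_prod hα hβ n hw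

lemma hasDerivAt_sqNorm_moment : HasDerivAt
    (fun w => sqNorm (momentFunctional (moment α β w)) n)
    (recB (momentFunctional (moment α β z)) n * sqNorm (momentFunctional (moment α β z)) n / z)
    z :=
  hasDerivAt_sqNorm (U := Set.Ioi 0) (fun _ hw => hasDerivAt_moment hα hβ hw)
    (fun _ hw _ hp => momentFunctional_mul_self_pos hα hβ hw hp) hz n

lemma differentiableAt_wronskianDet : DifferentiableAt ℝ (wronskianDet n (kummerM α β)) z := by
  refine DifferentiableAt.congr_of_eventuallyEq ?_ (wronskianDet_eventuallyEq hα hβ n hz)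
  exact DifferentiableAt.fun_finsetProd fun k _ =>
    (hasDerivAt_sqNorm_moment hα hβ k hz).differentiableAt

/-- `S_n = b_0 + ⋯ + b_{n-1}`, since `Δ_n = h_0 ⋯ h_{n-1}` and `z dh_k/dz = b_k h_k`. -/
lemma S_eq_sumB : S n α β z = sumB (momentFunctional (moment α β z)) n := by
  have hpos : ∀ {w : ℝ}, 0 < w → ∀ k, sqNorm (momentFunctional (moment α β w)) k ≠ 0 :=
    fun hw k => (sqNorm_pos (fun p hp => momentFunctional_mul_self_pos hα hβ hw hp) k).ne'
  have he : (fun w => Real.log (wronskianDet n (kummerM α β) w)) =ᶠ[𝓝 z]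
      fun w => ∑ k ∈ Finset.range n, Real.log (sqNorm (momentFunctional (moment α β w)) k) := by
    filter_upwards [lt_mem_nhds hz] with w hw
    rw [wronskianDet_eq_prod hα hβ n hw, Real.log_prod fun k _ => hpos hw k]
  have hd : HasDerivAt
      (fun w => ∑ k ∈ Finset.range n, Real.log (sqNorm (momentFunctional (moment α β w)) k))
      (∑ k ∈ Finset.range n, recB (momentFunctional (moment α β z)) k / z) z :=
    HasDerivAt.fun_sum fun k _ => by
      refine ((hasDerivAt_sqNorm_moment hα hβ k hz).log (hpos hz k)).congr_deriv ?_
      have := hpos hz k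
      field_simp
  rw [S, eulerOp, he.deriv_eq, hd.deriv, ← Finset.sum_div, mul_div_cancel₀ _ hz.ne', sumB]

lemma hasDerivAt_S : HasDerivAt (S n α β) (recA (momentFunctional (moment α β z)) n / z) z := by
  refine HasDerivAt.congr_of_eventuallyEq (hasDerivAt_sumB (U := Set.Ioi 0) isOpen_Ioi
    (fun _ hw => hasDerivAt_moment hα hβ hw)
    (fun _ hw _ hp => momentFunctional_mul_self_pos hα hβ hw hp) hz n) ?_
  filter_upwards [lt_mem_nhds hz] with w hw using S_eq_sumB hα hβ n hw

lemma deriv_S_eventuallyEq :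
    deriv (S n α β) =ᶠ[𝓝 z] fun w => recA (momentFunctional (moment α β w)) n / w := by
  filter_upwards [lt_mem_nhds hz] with w hw using (hasDerivAt_S hα hβ n hw).deriv

lemma hasDerivAt_deriv_S_zero : HasDerivAt (deriv (S 0 α β)) 0 z := by
  refine HasDerivAt.congr_of_eventuallyEq ?_ (deriv_S_eventuallyEq hα hβ 0 hz)
  simpa [recA] using hasDerivAt_const z (0 : ℝ)

lemma hasDerivAt_deriv_S_succ : HasDerivAt (deriv (S (n + 1) α β))
    (recA (momentFunctional (moment α β z)) (n + 1)
      * (recB (momentFunctional (moment α β z)) (n + 1)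
        - recB (momentFunctional (moment α β z)) n - 1) / z ^ 2) z := by
  refine HasDerivAt.congr_of_eventuallyEq ?_ (deriv_S_eventuallyEq hα hβ (n + 1) hz)
  refine ((hasDerivAt_recA_succ (U := Set.Ioi 0) (fun _ hw => hasDerivAt_moment hα hβ hw)
    (fun _ hw _ hp => momentFunctional_mul_self_pos hα hβ hw hp) hz n).fun_div
    (hasDerivAt_id z) hz.ne').congr_deriv ?_
  simp only [id]
  field_simp

lemma twiceDifferentiableAt_S : TwiceDifferentiableAt (S n α β) z := by
  refine ⟨?_, ?_⟩
  · filter_upwards [lt_mem_nhds hz] with w hw using (hasDerivAt_S hα hβ n hw).differentiableAt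
  · rcases n with - | n
    · exact (hasDerivAt_deriv_S_zero hα hβ hz).differentiableAt
    · exact (hasDerivAt_deriv_S_succ hα hβ n hz).differentiableAt

/-- With `A = a_{n+1}`, `b = b_{n+1}`, `b0 = b_n`, the linear relation turns the squared bracket of
the equation into `(A (2 n + 1 + 2 z - b - b0) / z) ^ 2`, the factorized relation turns the product into
`4 A ^ 2 (n + 1 + z - b) (n + z - b0) / z ^ 2`, and their difference is the square of
`A (b - b0 - 1) / z = z S''`. -/
theorem sEquation_S : SEquation n α β (S n α β) z := by
  have hz0 := hz.ne'
  rcases n with - | n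
  · rw [SEquation, (hasDerivAt_deriv_S_zero hα hβ hz).deriv, (hasDerivAt_S hα hβ 0 hz).deriv,
      S_eq_sumB hα hβ 0 hz]
    simp [sumB, recA]
  · have hL : ∀ p : ℝ[X], p ≠ 0 → 0 < momentFunctional (moment α β z) (p * p) :=
      fun p hp => momentFunctional_mul_self_pos hα hβ hz hp
    have hP := momentFunctional_pearson hα hβ hz
    have h1 := linear_relation hL hP n
    have h2 := factorized_relation hL hP n
    rw [SEquation, (hasDerivAt_deriv_S_succ hα hβ n hz).deriv,
      (hasDerivAt_S hα hβ (n + 1) hz).deriv, S_eq_sumB hα hβ (n + 1) hz]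
    push_cast
    generalize recA (momentFunctional (moment α β z)) (n + 1) = A at *
    generalize recB (momentFunctional (moment α β z)) (n + 1) = b at *
    generalize recB (momentFunctional (moment α β z)) n = b0 at *
    generalize sumB (momentFunctional (moment α β z)) (n + 1) = s at *
    have h3 : (z + (n + 1) + β - 1) * (A / z) - s - 1 / 2 * (n + 1) * (n + 1 - 1 + 2 * α)
        = A * (2 * n + 1 + 2 * z - b - b0) / z := by
      rw [eq_div_iff hz0]
      field_simp
      linear_combination 2 * h1
    have h4 : A / z * (A / z - (n + 1) - α + β) * (z * (A / z) - s + 1 / 2 * (n + 1) * (n + 1 - 1))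
        = A ^ 2 * (n + 1 + z - b) * (n + z - b0) / z ^ 2 := by
      rw [eq_div_iff (pow_ne_zero 2 hz0)]
      field_simp
      linear_combination -2 * A * h2
    have h5 : ∀ x y w : ℝ, 4 * x * y * w = 4 * (x * y * w) := fun x y w => by ring
    rw [h3, h5, h4]
    field_simp
    ring

end logDeriv

/-! ### The affine shift and the parameters -/

lemma TwiceDifferentiableAt.deriv_sub_shift {n : ℕ} {α β : ℝ} {f : ℝ → ℝ} {z : ℝ}
    (hf : TwiceDifferentiableAt f z) :
    deriv (fun x => f x - shift n α β x) z
        = deriv f z - (1 / 4 : ℝ) * (2 * α - β + 3 * n - 1) ∧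
      deriv (deriv fun x => f x - shift n α β x) z = deriv (deriv f) z := by
  have hs : ∀ y, HasDerivAt (shift n α β) ((1 / 4 : ℝ) * (2 * α - β + 3 * n - 1)) y := fun y => by
    have h := ((((hasDerivAt_id y).const_mul ((1 / 4 : ℝ) * (2 * α - β + 3 * n - 1))).add_const
      ((5 / 8 : ℝ) * n ^ 2)).add_const ((1 / 4 : ℝ) * (2 * α - 3 * β - 1) * n)).add_const
      ((1 / 8 : ℝ) * (2 * α - β - 1) ^ 2)
    rw [mul_one] at h
    exact h
  have h1 : deriv (fun x => f x - shift n α β x)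
      =ᶠ[𝓝 z] fun y => deriv f y - (1 / 4 : ℝ) * (2 * α - β + 3 * n - 1) := by
    filter_upwards [hf.1] with y hy
    exact (hy.hasDerivAt.sub (hs y)).deriv
  exact ⟨h1.eq_of_nhds, by rw [h1.deriv_eq, deriv_sub_const]⟩

lemma sEquation_iff_sigmaEquation {n : ℕ} {α β : ℝ} {f : ℝ → ℝ} {z : ℝ}
    (hf : TwiceDifferentiableAt f z) :
    SEquation n α β f z ↔
      SigmaEquation (kappa n α β) (fun x => f x - shift n α β x) z := by
  obtain ⟨h1, h2⟩ := hf.deriv_sub_shift (n := n) (α := α) (β := β)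
  rw [SEquation, SigmaEquation, h1, h2]
  simp only [Fin.prod_univ_four, kappa, shift, Matrix.cons_val]
  constructor <;> intro h <;> linear_combination h

lemma kappaPV_eq_kappa_iff (n : ℕ) (α β a b θ : ℝ) :
    kappaPV a b θ = kappa n α β ↔ a = α - 1 ∧ b = β - α - n ∧ θ = 1 - β - n := by
  constructor
  · intro h
    have h0 := congrFun h 0
    have h1 := congrFun h 1
    have h2 := congrFun h 2
    have h3 := congrFun h 3
    simp only [kappaPV, kappa, Matrix.cons_val] at h0 h1 h2 h3
    exact ⟨by linarith, by linarith, by linarith⟩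
  · rintro ⟨rfl, rfl, rfl⟩
    ext j
    fin_cases j <;> simp [kappaPV, kappa] <;> ring

/-! ### The Hamiltonian of the fifth Painlevé equation -/

section Hamiltonian

variable {a b θ : ℝ} {U : Set ℝ} {q p : ℝ → ℝ}

lemma hasDerivAt_hamV_snd (a b θ q p z : ℝ) : HasDerivAt (fun y => hamV a b θ q y z)
    (2 * q * (q - 1) ^ 2 * p - ((b + θ) * q ^ 2 - (2 * b + θ - z) * q + b)) p := by
  have h := ((((hasDerivAt_id p).fun_pow 2).const_mul (q * (q - 1) ^ 2)).sub
    ((hasDerivAt_id p).const_mul ((b + θ) * q ^ 2 - (2 * b + θ - z) * q + b))).sub_const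
    ((1 / 4 : ℝ) * (a ^ 2 - (b + θ) ^ 2) * q)
  refine h.congr_deriv ?_
  simp; ring

lemma hasDerivAt_hamV_fst (a b θ q p z : ℝ) : HasDerivAt (fun x => hamV a b θ x p z)
    ((3 * q ^ 2 - 4 * q + 1) * p ^ 2 - (2 * (b + θ) * q - (2 * b + θ - z)) * p
      - (1 / 4 : ℝ) * (a ^ 2 - (b + θ) ^ 2)) q := by
  have hx := hasDerivAt_id q
  have h := (((hx.fun_mul ((hx.sub_const 1).fun_pow 2)).mul_const (p ^ 2)).sub
    ((((hx.fun_pow 2).const_mul (b + θ)).sub (hx.const_mul (2 * b + θ - z))).add_const b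
      |>.mul_const p)).sub (hx.const_mul ((1 / 4 : ℝ) * (a ^ 2 - (b + θ) ^ 2)))
  refine h.congr_deriv ?_
  simp; ring

variable (hU : IsOpen U) (hpos : ∀ z ∈ U, 0 < z) (h : IsHamiltonianSolution a b θ U q p)
  {z : ℝ} (hz : z ∈ U)
include hpos h hz

lemma hamilton_hasDerivAt_fst : HasDerivAt q
    ((2 * q z * (q z - 1) ^ 2 * p z
      - ((b + θ) * q z ^ 2 - (2 * b + θ - z) * q z + b)) / z) z := by
  obtain ⟨hq, -, h1, -⟩ := h z hz
  rw [(hasDerivAt_hamV_snd ..).deriv] at h1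
  rw [← h1, mul_div_cancel_left₀ _ (hpos z hz).ne']
  exact hq.hasDerivAt

lemma hamilton_hasDerivAt_snd : HasDerivAt p
    (-((3 * q z ^ 2 - 4 * q z + 1) * p z ^ 2 - (2 * (b + θ) * q z - (2 * b + θ - z)) * p z
      - (1 / 4 : ℝ) * (a ^ 2 - (b + θ) ^ 2)) / z) z := by
  obtain ⟨-, hp, -, h1⟩ := h z hz
  rw [(hasDerivAt_hamV_fst ..).deriv] at h1
  rw [← h1, mul_div_cancel_left₀ _ (hpos z hz).ne']
  exact hp.hasDerivAt

/-- Along solutions the total derivative of the Hamiltonian is its explicit derivative `-q p` in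
`z`. -/
lemma hasDerivAt_sigmaOfHam : HasDerivAt (sigmaOfHam a b θ q p)
    (-(q z * p z) + (1 / 4 : ℝ) * (2 * b + θ)) z := by
  have hq := hamilton_hasDerivAt_fst hpos h hz
  have hp := hamilton_hasDerivAt_snd hpos h hz
  have hne := (hpos z hz).ne'
  have hx := hasDerivAt_id z
  have hH := ((((hq.fun_mul ((hq.sub_const 1).fun_pow 2)).fun_mul (hp.fun_pow 2)).sub
    (((((hq.fun_pow 2).const_mul (b + θ)).sub ((hx.const_sub (2 * b + θ)).fun_mul hq)).add_const
      b).fun_mul hp)).sub (hq.const_mul ((1 / 4 : ℝ) * (a ^ 2 - (b + θ) ^ 2)))).add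
    (hx.const_mul ((1 / 4 : ℝ) * (2 * b + θ))) |>.sub_const ((1 / 8 : ℝ) * (2 * b + θ) ^ 2)
  refine hH.congr_deriv ?_
  simp
  field_simp
  ring

include hU

lemma deriv_sigmaOfHam_eventuallyEq : deriv (sigmaOfHam a b θ q p)
    =ᶠ[𝓝 z] fun y => -(q y * p y) + (1 / 4 : ℝ) * (2 * b + θ) := by
  filter_upwards [hU.mem_nhds hz] with y hy
  exact (hasDerivAt_sigmaOfHam hpos h hy).deriv

lemma hasDerivAt_deriv_sigmaOfHam : HasDerivAt (deriv (sigmaOfHam a b θ q p))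
    (-((q z - q z ^ 3) * p z ^ 2 + ((b + θ) * q z ^ 2 - b) * p z
        + (1 / 4 : ℝ) * (a ^ 2 - (b + θ) ^ 2) * q z) / z) z := by
  have hq := hamilton_hasDerivAt_fst hpos h hz
  have hp := hamilton_hasDerivAt_snd hpos h hz
  have hne := (hpos z hz).ne'
  refine HasDerivAt.congr_of_eventuallyEq ?_ (deriv_sigmaOfHam_eventuallyEq hU hpos h hz)
  refine ((hq.fun_mul hp).fun_neg.add_const _).congr_deriv ?_
  field_simp
  ring

lemma hasDerivAt_deriv_fst : HasDerivAt (deriv q)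
    ((2 * ((q z - 1) ^ 2 + 2 * q z * (q z - 1)) * p z * deriv q z
        + 2 * q z * (q z - 1) ^ 2 * deriv p z
        - (2 * (b + θ) * q z - (2 * b + θ - z)) * deriv q z - q z - deriv q z) / z) z := by
  have hq := hamilton_hasDerivAt_fst hpos h hz
  have hne := (hpos z hz).ne'
  have hq' := hq.deriv
  have he : deriv q =ᶠ[𝓝 z] fun y => (2 * q y * (q y - 1) ^ 2 * p y
      - ((b + θ) * q y ^ 2 - (2 * b + θ - y) * q y + b)) / y := by
    filter_upwards [hU.mem_nhds hz] with y hy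
    exact (hamilton_hasDerivAt_fst hpos h hy).deriv
  have hdq := hq.differentiableAt.hasDerivAt
  have hdp := (hamilton_hasDerivAt_snd hpos h hz).differentiableAt.hasDerivAt
  have hx := hasDerivAt_id z
  refine HasDerivAt.congr_of_eventuallyEq ?_ he
  have hN := (((hdq.const_mul 2).fun_mul ((hdq.sub_const 1).fun_pow 2)).fun_mul hdp).fun_sub
    ((((hdq.fun_pow 2).const_mul (b + θ)).fun_sub
      ((hx.const_sub (2 * b + θ)).fun_mul hdq)).add_const b)
  refine (hN.fun_div hx hne).congr_deriv ?_
  simp only [id]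
  rw [eq_div_iff hne] at hq'
  rw [div_eq_div_iff (pow_ne_zero 2 hne) hne]
  simp
  linear_combination z * hq'

lemma twiceDifferentiableAt_fst : TwiceDifferentiableAt q z :=
  ⟨Filter.eventually_of_mem (hU.mem_nhds hz) fun _ hy => (h _ hy).1,
    (hasDerivAt_deriv_fst hU hpos h hz).differentiableAt⟩

lemma twiceDifferentiableAt_sigmaOfHam : TwiceDifferentiableAt (sigmaOfHam a b θ q p) z :=
  ⟨Filter.eventually_of_mem (hU.mem_nhds hz) fun _ hy =>
      (hasDerivAt_sigmaOfHam hpos h hy).differentiableAt,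
    (hasDerivAt_deriv_sigmaOfHam hU hpos h hz).differentiableAt⟩

lemma sigmaEquation_sigmaOfHam : SigmaEquation (kappaPV a b θ) (sigmaOfHam a b θ q p) z := by
  have hne := (hpos z hz).ne'
  rw [SigmaEquation, (hasDerivAt_deriv_sigmaOfHam hU hpos h hz).deriv,
    (hasDerivAt_sigmaOfHam hpos h hz).deriv, mul_div_cancel₀ _ hne]
  simp only [Fin.prod_univ_four, kappaPV, Matrix.cons_val, sigmaOfHam, hamV]
  ring

lemma painleveV_fst (h0 : q z ≠ 0) (h1 : q z ≠ 1) :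
    PainleveV (a ^ 2 / 2) (-(b ^ 2 / 2)) (-(θ + 1)) (-(1 / 2)) q z := by
  have hne := (hpos z hz).ne'
  have h1' : q z - 1 ≠ 0 := sub_ne_zero.2 h1
  rw [PainleveV, (hasDerivAt_deriv_fst hU hpos h hz).deriv,
    (hamilton_hasDerivAt_snd hpos h hz).deriv, (hamilton_hasDerivAt_fst hpos h hz).deriv]
  field_simp
  ring

end Hamiltonian

end GenMeixner

theorem theorem5p4 (n : ℕ) (α β : ℝ) (hα : 0 < α) (hβ : 0 < β) :
    -- `S_n` comes from the generalized Meixner weight, is well defined, and solves its equation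
    (∀ z : ℝ, 0 < z →
      (∀ j : ℕ, Summable fun k : ℕ => (k : ℝ) ^ j * GenMeixner.weight α β z k) ∧
      GenMeixner.hankelDet n α β z
        = GenMeixner.wronskianDet n (GenMeixner.kummerM α β) z ∧
      0 < GenMeixner.wronskianDet n (GenMeixner.kummerM α β) z ∧
      DifferentiableAt ℝ (GenMeixner.wronskianDet n (GenMeixner.kummerM α β)) z ∧
      GenMeixner.TwiceDifferentiableAt (GenMeixner.S n α β) z ∧
      GenMeixner.SEquation n α β (GenMeixner.S n α β) z) ∧
    -- the affine shift turns the equation into the `σ`-equation, for every function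
    (∀ (f : ℝ → ℝ) (z : ℝ), GenMeixner.TwiceDifferentiableAt f z →
      (GenMeixner.SEquation n α β f z ↔
        GenMeixner.SigmaEquation (GenMeixner.kappa n α β)
          (fun x => f x - GenMeixner.shift n α β x) z)) ∧
    -- in particular the shifted `S_n` solves the `σ`-equation
    (∀ z : ℝ, 0 < z →
      GenMeixner.SigmaEquation (GenMeixner.kappa n α β)
        (fun x => GenMeixner.S n α β x - GenMeixner.shift n α β x) z) ∧
    -- the corresponding parameters `(a, b, θ)`
    (∀ a b θ : ℝ, GenMeixner.kappaPV a b θ = GenMeixner.kappa n α β ↔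
      a = α - 1 ∧ b = β - α - n ∧ θ = 1 - β - n) ∧
    -- for these parameters, the equation is the one satisfied by the Hamiltonian function of
    -- the fifth Painlevé equation
    (∀ (U : Set ℝ) (q p : ℝ → ℝ), IsOpen U → (∀ z ∈ U, 0 < z) →
      GenMeixner.IsHamiltonianSolution (α - 1) (β - α - n) (1 - β - n) U q p →
      ∀ z ∈ U,
        GenMeixner.TwiceDifferentiableAt
          (GenMeixner.sigmaOfHam (α - 1) (β - α - n) (1 - β - n) q p) z ∧
        GenMeixner.SigmaEquation (GenMeixner.kappa n α β)
          (GenMeixner.sigmaOfHam (α - 1) (β - α - n) (1 - β - n) q p) z ∧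
        GenMeixner.TwiceDifferentiableAt q z ∧
        (q z ≠ 0 → q z ≠ 1 →
          GenMeixner.PainleveV ((α - 1) ^ 2 / 2) (-((β - α - n) ^ 2 / 2)) (β + n - 2) (-(1 / 2))
            q z)) := by
  open GenMeixner in
  refine ⟨fun z hz => ⟨summable_pow_mul_weight hα hβ hz, hankelDet_eq_wronskianDet hα hβ hz n,
    wronskianDet_pos hα hβ n hz, differentiableAt_wronskianDet hα hβ n hz,
    twiceDifferentiableAt_S hα hβ n hz, sEquation_S hα hβ n hz⟩,
    fun f z hf => sEquation_iff_sigmaEquation hf,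
    fun z hz => (sEquation_iff_sigmaEquation (twiceDifferentiableAt_S hα hβ n hz)).1
      (sEquation_S hα hβ n hz),
    kappaPV_eq_kappa_iff n α β, fun U q p hU hpos h z hz => ⟨?_, ?_, ?_, fun h0 h1 => ?_⟩⟩
  · exact twiceDifferentiableAt_sigmaOfHam hU hpos h hz
  · rw [← (kappaPV_eq_kappa_iff n α β _ _ _).2 ⟨rfl, rfl, rfl⟩]
    exact sigmaEquation_sigmaOfHam hU hpos h hz
  · exact twiceDifferentiableAt_fst hU hpos h hz
  · have hC : β + n - 2 = -(1 - β - n + 1) := by ring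
    rw [hC]
    exact painleveV_fst hU hpos h hz h0 h1
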